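/- Let $A$ be the renewal matrix on the alphabet $\{1,2,3,\dots\}$: $A(1,n)=A(n+1,n)=1$ for all $n\ge 1$, and all other entries are $0$. Let $\Sigma_A$ be the one-sided Markov shift of sequences $x_0x_1x_2\cdots$ with $A(x_j,x_{j+1})=1$ for all $j\ge 0$. On $\ell^2(\Sigma_A)$ with canonical basis $(\delta_x)_{x\in\Sigma_A}$ let $T_s$ be the partial isometry with $T_s\delta_x=\delta_{sx}$ if $A(s,x_0)=1$ and $T_s\delta_x=0$ otherwise. For a finite word $\alpha=\alpha_0\cdots\alpha_n$ put $T_\alpha=T_{\alpha_0}\cdots T_{\alpha_n}$ (with $T_e=1$ for the empty word $e$), and put $Q_i=T_i^*T_i$. Let $\mathcal D_A$ be the commutative unital $C^*$-algebra generated by the operators $T_\alpha\big(\prod_{i\in F}Q_i\big)T_\alpha^*$, with $\alpha$ a finite word and $F$ a finite set of letters. Let $X_A$ be the spectrum of $\mathcal D_A$ (the space of its characters with the weak-$*$ topology), with its Borel $\sigma$-algebra. Regard $\Sigma_A$ as a subset of $X_A$ by identifying $x$ with the character $R\mapsto\langle R\delta_x,\delta_x\rangle$. Let $U\subseteq X_A$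 be the set of those $\xi$ for which there is a (necessarily unique) letter $s$ with $\xi(T_sT_s^*)=1$, and let the shift $\sigma:U\to X_A$ be given by $\sigma(\xi)(R)=\xi(T_sRT_s^*)$; it extends the shift of $\Sigma_A$. For $\beta\in\mathbb R$, a Borel measure $\mu$ on $X_A$ is called $e^\beta$-conformal (in the sense of Denker and Urbański, for the constant potential $f\equiv 1$) if $\mu(\sigma(E))=\int_E e^{\beta}\,d\mu$ for every Borel set $E\subseteq U$ on which $\sigma$ is injective. Set $\beta_c=\log 2$. Then: 1. For every $\beta>\beta_c$ there is a unique $e^\beta$-conformal Borel probability measure $\mu$ on $X_A$ with $\mu(\Sigma_A)=0$. 2. For every $\beta\le\beta_c$ there is no $e^\beta$-conformal Borel probability measure $\mu$ on $X_A$ with $\mu(\Sigma_A)=0$. 3. At $\beta=\beta_c$ the series $\sum_{\omega}e^{-\beta_c|\omega|}$, taken over all nonempty finite $A$-admissible words $\omega$ that end with the letter $1$ (where $|\omega|$ is the length of $\omega$), diverges. -/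

import Mathlib

open scoped ENNReal lp

noncomputable section

namespace RenewalShift

/-! ### Countable Markov shifts over the alphabet `{1, 2, 3, …}` -/

/-- The one-sided Markov shift space `Σ_A` of the 0-1 matrix `A` (`A i j` means that the entry
`(i, j)` equals `1`). -/
@[ext]
structure MarkovShift (A : ℕ+ → ℕ+ → Prop) : Type where
  /-- the letters `x₀, x₁, x₂, …` -/
  letter : ℕ → ℕ+
  admissible : ∀ j, A (letter j) (letter (j + 1))

/-- The renewal matrix: `A(1, n) = A(n + 1, n) = 1` for all `n`, all other entries are `0`. -/
def renewal (i j : ℕ+) : Prop := i = 1 ∨ i = j + 1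

variable {A : ℕ+ → ℕ+ → Prop}

namespace MarkovShift

/-- The shift map `x₀x₁x₂⋯ ↦ x₁x₂⋯` on `Σ_A`. -/
def tail (x : MarkovShift A) : MarkovShift A := ⟨fun j => x.letter (j + 1), fun j => x.admissible (j + 1)⟩

/-- The sequence `s x₀x₁⋯`, for a letter `s` with `A(s, x₀) = 1`. -/
def cons (s : ℕ+) (x : MarkovShift A) (h : A s (x.letter 0)) : MarkovShift A :=
  ⟨fun j => Nat.casesOn j s x.letter, fun j => by cases j with
    | zero => exact h
    | succ k => exact x.admissible k⟩

theorem tail_injOn (s : ℕ+) : Set.InjOn (tail (A := A)) {x | x.letter 0 = s} := by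
  intro x hx y hy h
  ext j : 2
  cases j with
  | zero => exact hx.trans hy.symm
  | succ k => exact congrFun (congrArg MarkovShift.letter h) k

theorem eq_cons_iff {s : ℕ+} {x y : MarkovShift A} (h : A s (x.letter 0)) :
    y = cons s x h ↔ y.letter 0 = s ∧ y.tail = x := by
  constructor
  · rintro rfl
    exact ⟨rfl, rfl⟩
  · rintro ⟨h0, rfl⟩
    exact tail_injOn s h0 rfl rfl

end MarkovShift

/-! ### The operators `T_s` on `ℓ²(Σ_A)` -/

/-- The Hilbert space `ℓ²(Σ_A)`. -/
abbrev H (A : ℕ+ → ℕ+ → Prop) : Type := lp (fun _ : MarkovShift A => ℂ) 2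

open Classical in
/-- The vector `δ_x` of the canonical basis of `ℓ²(Σ_A)`. -/
def delta (x : MarkovShift A) : H A := lp.single 2 x (1 : ℂ)

open Classical in
theorem summable_T (s : ℕ+) (v : H A) :
    Summable (fun y : MarkovShift A => ‖(if y.letter 0 = s then v y.tail else 0 : ℂ)‖ ^ (2 : ℝ)) ∧
    ∑' y : MarkovShift A, ‖(if y.letter 0 = s then v y.tail else 0 : ℂ)‖ ^ (2 : ℝ)
      ≤ ‖v‖ ^ (2 : ℝ) := by
  have hv : HasSum (fun x => ‖v x‖ ^ (2 : ℝ)) (‖v‖ ^ (2 : ℝ)) := by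
    simpa using lp.hasSum_norm (p := 2) (by norm_num) v
  set S : Set (MarkovShift A) := {x | x.letter 0 = s}
  have hinj : Function.Injective (fun y : S => (y : MarkovShift A).tail) :=
    (MarkovShift.tail_injOn s).injective
  have hfun : (fun y : MarkovShift A => ‖(if y.letter 0 = s then v y.tail else 0 : ℂ)‖ ^ (2 : ℝ))
      = S.indicator (fun y => ‖v y.tail‖ ^ (2 : ℝ)) := by
    funext y
    by_cases hy : y.letter 0 = s
    · simp [S, hy]
    · simp [S, hy]
  rw [hfun]
  have hs : Summable (fun y : S => ‖v (y : MarkovShift A).tail‖ ^ (2 : ℝ)) :=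
    hv.summable.comp_injective hinj
  refine ⟨summable_subtype_iff_indicator.mp hs, ?_⟩
  rw [← tsum_subtype S (fun y => ‖v y.tail‖ ^ (2 : ℝ)), ← hv.tsum_eq]
  exact hs.tsum_le_tsum_of_inj _ hinj (fun _ _ => by positivity) (fun _ => le_rfl) hv.summable

open Classical in
/-- The partial isometry `T_s` on `ℓ²(Σ_A)`: `T_s δ_x = δ_{sx}` if `A(s, x₀) = 1`, and
`T_s δ_x = 0` otherwise (see `T_delta`). -/
def T (s : ℕ+) : H A →L[ℂ] H A :=
  LinearMap.mkContinuous
    { toFun := fun v => ⟨fun y => if y.letter 0 = s then v y.tail else 0,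
        memℓp_gen (by simpa using (summable_T s v).1)⟩
      map_add' := fun v w => by
        ext y
        change (if y.letter 0 = s then v y.tail + w y.tail else 0 : ℂ)
          = (if y.letter 0 = s then v y.tail else 0) + (if y.letter 0 = s then w y.tail else 0)
        by_cases hy : y.letter 0 = s <;> simp [hy]
      map_smul' := fun c v => by
        ext y
        by_cases hy : y.letter 0 = s <;> simp [hy] }
    1 (fun v => by
      rw [one_mul]
      refine lp.norm_le_of_tsum_le (p := 2) (by norm_num) (norm_nonneg v) ?_
      simpa using (summable_T s v).2)

open Classical in
theorem T_apply (s : ℕ+) (v : H A) (y : MarkovShift A) :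
    T s v y = if y.letter 0 = s then v y.tail else 0 := rfl

open Classical in
theorem T_delta (s : ℕ+) (x : MarkovShift A) :
    T s (delta x) = if h : A s (x.letter 0) then delta (x.cons s h) else 0 := by
  ext y
  rw [T_apply]
  split_ifs with h1 h2 h2
  · by_cases h3 : y.tail = x
    · have : y = x.cons s h2 := (MarkovShift.eq_cons_iff h2).2 ⟨h1, h3⟩
      rw [← this, h3]; simp [delta]
    · have : y ≠ x.cons s h2 := fun h => h3 ((MarkovShift.eq_cons_iff h2).1 h).2
      simp [delta, h3, this]
  · have : y.tail ≠ x := by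
      rintro rfl
      exact h2 (h1 ▸ y.admissible 0)
    simp [delta, this]
  · have : y ≠ x.cons s h2 := fun h => h1 ((MarkovShift.eq_cons_iff h2).1 h).1
    simp [delta, this]
  · simp

theorem T_apply_cons (s : ℕ+) (v : H A) (x : MarkovShift A) (h : A s (x.letter 0)) :
    T s v (x.cons s h) = v x := by
  classical
  exact (T_apply s v (x.cons s h)).trans (if_pos rfl)

theorem T_apply_cons_of_ne {s t : ℕ+} (hst : s ≠ t) (v : H A) (x : MarkovShift A)
    (h : A s (x.letter 0)) : T t v (x.cons s h) = 0 := by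
  classical
  exact (T_apply t v (x.cons s h)).trans (if_neg hst)

theorem inner_delta (x : MarkovShift A) (v : H A) : inner ℂ (delta x) v = v x := by
  classical
  simp [delta, lp.inner_single_left]

theorem star_T_apply (s : ℕ+) (v : H A) (x : MarkovShift A) (h : A s (x.letter 0)) :
    star (T s) v x = v (x.cons s h) := by
  rw [← inner_delta x, ContinuousLinearMap.star_eq_adjoint,
    ContinuousLinearMap.adjoint_inner_right, T_delta, dif_pos h, inner_delta]

theorem star_T_apply_of_not (s : ℕ+) (v : H A) (x : MarkovShift A) (h : ¬ A s (x.letter 0)) :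
    star (T s) v x = 0 := by
  rw [← inner_delta x, ContinuousLinearMap.star_eq_adjoint,
    ContinuousLinearMap.adjoint_inner_right, T_delta, dif_neg h, inner_zero_left]

/-- `T_α = T_{α₀} T_{α₁} ⋯ T_{αₙ}` for a finite word `α`, with `T_e = 1` for the empty word. -/
def Tword (α : List ℕ+) : H A →L[ℂ] H A := (α.map T).prod

/-- The projection `P_s = T_s T_s^*`. -/
def P (s : ℕ+) : H A →L[ℂ] H A := T s * star (T s)

/-- The projection `Q_s = T_s^* T_s`. -/
def Q (s : ℕ+) : H A →L[ℂ] H A := star (T s) * T s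

/-! ### The commutative C⋆-algebra `D_A` -/

/-- The generators `T_α (∏_{i ∈ F} Q_i) T_α^*`, `α` a finite word, `F` a finite set of letters.
The `Q_i` are commuting projections, so it is harmless to let `F` be a list. -/
def gens (A : ℕ+ → ℕ+ → Prop) : Set (H A →L[ℂ] H A) :=
  {R | ∃ α F : List ℕ+, R = Tword α * (F.map Q).prod * star (Tword α)}

/-- The unital C⋆-subalgebra of the bounded operators on `ℓ²(Σ_A)` that is generated by the
operators `T_α (∏_{i ∈ F} Q_i) T_α^*`. When the C⋆-algebra generated by the `T_s` is unital, as
for the renewal matrix, where `Q_1 = 1` (see `Q_one_renewal`), this is the algebra `D_A`. -/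
def D (A : ℕ+ → ℕ+ → Prop) : StarSubalgebra ℂ (H A →L[ℂ] H A) :=
  (StarAlgebra.adjoin ℂ (gens A)).topologicalClosure

theorem Q_one_renewal : (Q 1 : H renewal →L[ℂ] H renewal) = 1 := by
  ext v x
  have h : renewal 1 (x.letter 0) := Or.inl rfl
  change star (T 1) (T 1 v) x = v x
  rw [star_T_apply _ _ _ h, T_apply_cons]

/-- An operator on `ℓ²(Σ_A)` which is diagonal in the canonical basis. -/
def IsDiag (R : H A →L[ℂ] H A) : Prop := ∀ v x, R v x = R (delta x) x * v x

theorem delta_self (x : MarkovShift A) : delta x x = 1 := by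
  classical
  simp [delta]

theorem isDiag_of {R : H A →L[ℂ] H A} (d : MarkovShift A → ℂ) (h : ∀ v x, R v x = d x * v x) :
    IsDiag R := fun v x => by rw [h, h, delta_self, mul_one]

theorem IsDiag.apply_delta {R : H A →L[ℂ] H A} (hR : IsDiag R) (x : MarkovShift A) :
    R (delta x) = (R (delta x) x) • delta x := by
  classical
  ext y
  rw [hR]
  by_cases h : y = x
  · subst h; simp
  · simp [delta, h]

theorem IsDiag.star {R : H A →L[ℂ] H A} (hR : IsDiag R) : IsDiag (star R) := by
  refine isDiag_of (fun x => starRingEnd ℂ (R (delta x) x)) (fun v x => ?_)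
  rw [← inner_delta x, ContinuousLinearMap.star_eq_adjoint,
    ContinuousLinearMap.adjoint_inner_right, hR.apply_delta, inner_smul_left, inner_delta,
    lp.coeFn_smul, Pi.smul_apply, delta_self, smul_eq_mul, mul_one]

theorem IsDiag.mul {R S : H A →L[ℂ] H A} (hR : IsDiag R) (hS : IsDiag S) : IsDiag (R * S) :=
  isDiag_of (fun x => R (delta x) x * S (delta x) x) (fun v x => by
    change R (S v) x = _
    rw [hR, hS, mul_assoc])

theorem IsDiag.commute {R S : H A →L[ℂ] H A} (hR : IsDiag R) (hS : IsDiag S) :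
    R * S = S * R := by
  ext v x
  change R (S v) x = S (R v) x
  rw [hR, hS, hS (R v), hR v]
  ring

theorem isClosed_isDiag : IsClosed {R : H A →L[ℂ] H A | IsDiag R} := by
  have : {R : H A →L[ℂ] H A | IsDiag R} = ⋂ (v : H A) (x : MarkovShift A),
      {R | inner ℂ (delta x) (R v) = inner ℂ (delta x) (R (delta x)) * v x} := by
    ext R
    simp [IsDiag, inner_delta]
  rw [this]
  refine isClosed_iInter fun v => isClosed_iInter fun x => isClosed_eq ?_ ?_ <;> fun_prop

/-- The C⋆-algebra of all diagonal operators. -/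
def diagAlg (A : ℕ+ → ℕ+ → Prop) : StarSubalgebra ℂ (H A →L[ℂ] H A) where
  carrier := {R | IsDiag R}
  mul_mem' := IsDiag.mul
  add_mem' := fun {R S} hR hS => isDiag_of (fun x => R (delta x) x + S (delta x) x) (fun v x => by
    change R v x + S v x = _
    rw [hR, hS, add_mul])
  algebraMap_mem' := fun c => isDiag_of (fun _ => c) (fun v x => by
    simp [Algebra.algebraMap_eq_smul_one])
  star_mem' := IsDiag.star

theorem IsDiag.conj {R : H A →L[ℂ] H A} (hR : IsDiag R) (s : ℕ+) :
    IsDiag (T s * R * Star.star (T s)) := by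
  classical
  refine isDiag_of (fun x => if x.letter 0 = s then R (delta x.tail) x.tail else 0) (fun v x => ?_)
  change T s (R (Star.star (T s) v)) x = _
  rw [T_apply]
  split_ifs with h
  · have h' : A s (x.tail.letter 0) := h ▸ x.admissible 0
    rw [hR, star_T_apply _ _ _ h', ← (MarkovShift.eq_cons_iff h').2 ⟨h, rfl⟩]
  · simp

theorem isDiag_Q (s : ℕ+) : IsDiag (Q s : H A →L[ℂ] H A) := by
  classical
  refine isDiag_of (fun x => if A s (x.letter 0) then 1 else 0) (fun v x => ?_)
  change Star.star (T s) (T s v) x = _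
  split_ifs with h
  · rw [star_T_apply _ _ _ h, T_apply_cons, one_mul]
  · rw [star_T_apply_of_not _ _ _ h, zero_mul]

theorem T_mul_Q (s : ℕ+) : T s * Q s = (T s : H A →L[ℂ] H A) := by
  ext v y
  change T s (Q s v) y = T s v y
  rw [T_apply, T_apply]
  split_ifs with h
  · have h' : A s (y.tail.letter 0) := h ▸ y.admissible 0
    change star (T s) (T s v) y.tail = _
    rw [star_T_apply _ _ _ h', T_apply_cons]
  · rfl

theorem P_mul_P_of_ne {s t : ℕ+} (h : s ≠ t) : P s * P t = (0 : H A →L[ℂ] H A) := by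
  ext v y
  change T s (star (T s) (T t (star (T t) v))) y = 0
  rw [T_apply]
  split_ifs with h1
  · have h' : A s (y.tail.letter 0) := h1 ▸ y.admissible 0
    rw [star_T_apply _ _ _ h', T_apply_cons_of_ne h]
  · rfl

theorem Tword_cons (s : ℕ+) (α : List ℕ+) :
    (Tword (s :: α) : H A →L[ℂ] H A) = T s * Tword α := by
  simp [Tword]

theorem gens_conj {R : H A →L[ℂ] H A} (hR : R ∈ gens A) (s : ℕ+) :
    T s * R * star (T s) ∈ gens A := by
  obtain ⟨α, F, rfl⟩ := hR
  exact ⟨s :: α, F, by rw [Tword_cons, star_mul]; simp only [mul_assoc]⟩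

theorem isDiag_of_mem_gens {R : H A →L[ℂ] H A} (hR : R ∈ gens A) : IsDiag R := by
  obtain ⟨α, F, rfl⟩ := hR
  induction α with
  | nil =>
    have : (F.map Q).prod ∈ diagAlg A :=
      list_prod_mem (by
        intro S hS
        obtain ⟨i, -, rfl⟩ := List.mem_map.mp hS
        exact isDiag_Q i)
    simpa [Tword] using (show IsDiag _ from this)
  | cons s α ih =>
    have := ih.conj s
    rw [Tword_cons, star_mul]
    simpa only [mul_assoc] using this

theorem adjoin_le_diagAlg : StarAlgebra.adjoin ℂ (gens A) ≤ diagAlg A :=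
  StarAlgebra.adjoin_le fun _ hR => isDiag_of_mem_gens hR

theorem isDiag_of_mem_D {R : H A →L[ℂ] H A} (hR : R ∈ D A) : IsDiag R :=
  StarSubalgebra.topologicalClosure_minimal adjoin_le_diagAlg isClosed_isDiag hR

theorem conj_mul {R S : H A →L[ℂ] H A} (hR : IsDiag R) (s : ℕ+) :
    T s * (R * S) * star (T s) = (T s * R * star (T s)) * (T s * S * star (T s)) := by
  calc T s * (R * S) * star (T s) = (T s * Q s) * (R * S) * star (T s) := by rw [T_mul_Q]
    _ = T s * (Q s * R) * S * star (T s) := by simp only [mul_assoc]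
    _ = T s * (R * Q s) * S * star (T s) := by rw [(isDiag_Q s).commute hR]
    _ = _ := by simp only [Q, mul_assoc]

theorem gens_subset_D {R : H A →L[ℂ] H A} (hR : R ∈ gens A) : R ∈ D A :=
  StarSubalgebra.le_topologicalClosure _ (StarAlgebra.subset_adjoin ℂ _ hR)

theorem P_mem_D (s : ℕ+) : P s ∈ D A :=
  gens_subset_D ⟨[s], [], by simp [Tword, P]⟩

theorem conj_mem_D (s : ℕ+) {R : H A →L[ℂ] H A} (hR : R ∈ D A) :
    T s * R * star (T s) ∈ D A := by
  have key : ∀ S ∈ StarAlgebra.adjoin ℂ (gens A),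
      T s * S * star (T s) ∈ StarAlgebra.adjoin ℂ (gens A) := by
    intro S hS
    induction hS using StarAlgebra.adjoin_induction with
    | mem x hx => exact StarAlgebra.subset_adjoin ℂ _ (gens_conj hx s)
    | algebraMap r =>
      have h : P s ∈ StarAlgebra.adjoin ℂ (gens A) :=
        StarAlgebra.subset_adjoin ℂ _ ⟨[s], [], by simp [Tword, P]⟩
      have h2 : T s * algebraMap ℂ _ r * star (T s) = r • (P s : H A →L[ℂ] H A) := by
        simp [Algebra.algebraMap_eq_smul_one, P]
      rw [h2]
      exact (StarAlgebra.adjoin ℂ (gens A)).smul_mem h r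
    | add x y _ _ hx hy => rw [mul_add, add_mul]; exact add_mem hx hy
    | mul x y hx' _ hx hy => rw [conj_mul (adjoin_le_diagAlg hx')]; exact mul_mem hx hy
    | star x _ hx =>
      have := star_mem hx
      simpa [star_mul, mul_assoc] using this
  exact map_mem_closure (f := fun S : H A →L[ℂ] H A => T s * S * star (T s))
    (by fun_prop) hR key

/-! ### The space `X_A`, the inclusion of `Σ_A`, and the shift on `X_A` -/

/-- The spectrum of `D_A`: the nonzero characters `D_A → ℂ`. It carries the weak-⋆ topology. -/
abbrev X (A : ℕ+ → ℕ+ → Prop) : Type := WeakDual.characterSpace ℂ (D A)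

/-- The Borel σ-algebra of `X_A`. -/
instance instMeasurableSpaceX : MeasurableSpace (X A) := borel (X A)

instance instBorelSpaceX : BorelSpace (X A) := ⟨rfl⟩

/-- The inclusion `Σ_A → X_A` which maps `x` to the character `R ↦ ⟨R δ_x, δ_x⟩`. (The inner
product of Mathlib is linear in its second argument.) -/
def incl (x : MarkovShift A) : X A :=
  ⟨((innerSL ℂ (delta x)).comp
      ((ContinuousLinearMap.apply ℂ (H A) (delta x)).comp (D A).toSubalgebra.toSubmodule.subtypeL) :
        D A →L[ℂ] ℂ), by
    constructor
    · intro h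
      have h1 : inner ℂ (delta x) ((1 : H A →L[ℂ] H A) (delta x)) = 0 :=
        DFunLike.congr_fun h (1 : D A)
      rw [inner_delta] at h1
      exact one_ne_zero ((delta_self x).symm.trans h1)
    · intro R S
      change inner ℂ (delta x) (R.1 (S.1 (delta x)))
        = inner ℂ (delta x) (R.1 (delta x)) * inner ℂ (delta x) (S.1 (delta x))
      rw [inner_delta, inner_delta, inner_delta, isDiag_of_mem_D R.2]⟩

theorem incl_apply (x : MarkovShift A) (R : D A) :
    incl x R = inner ℂ (delta x) ((R : H A →L[ℂ] H A) (delta x)) := rfl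

/-- `Σ_A` as a subset of `X_A`. -/
def SigmaA (A : ℕ+ → ℕ+ → Prop) : Set (X A) := Set.range incl

/-- The map `R ↦ T_s R T_s^*` on `D_A`. -/
def conjD (s : ℕ+) : D A →L[ℂ] D A where
  toFun R := ⟨T s * R.1 * star (T s), conj_mem_D s R.2⟩
  map_add' R S := Subtype.ext (by simp [mul_add, add_mul])
  map_smul' c R := Subtype.ext (by simp)
  cont := Continuous.subtype_mk (by fun_prop) _

/-- `ξ` has the first letter `s`: the word `s` is filled in the configuration of `ξ`, that is,
`ξ(T_s T_s^*) = 1`. -/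
def HasFirstLetter (ξ : X A) (s : ℕ+) : Prop := ξ ⟨P s, P_mem_D s⟩ = 1

theorem HasFirstLetter.unique {ξ : X A} {s t : ℕ+} (hs : HasFirstLetter ξ s)
    (ht : HasFirstLetter ξ t) : s = t := by
  by_contra h
  have h0 : (⟨P s, P_mem_D s⟩ * ⟨P t, P_mem_D t⟩ : D A) = 0 := Subtype.ext (P_mul_P_of_ne h)
  have h1 := map_mul ξ (⟨P s, P_mem_D s⟩ : D A) ⟨P t, P_mem_D t⟩
  rw [h0, map_zero, hs, ht, mul_one] at h1
  exact zero_ne_one h1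

/-- The domain of the shift: the elements of `X_A` with a nonempty stem. For the renewal matrix
this is all of `X_A` but one point. -/
def shiftDomain (A : ℕ+ → ℕ+ → Prop) : Set (X A) := {ξ | ∃ s, HasFirstLetter ξ s}

/-- The removal of the first letter `s`: the character `R ↦ ξ(T_s R T_s^*)`. -/
def removeLetter (s : ℕ+) (ξ : X A) (h : HasFirstLetter ξ s) : X A :=
  ⟨((WeakDual.toStrongDual (ξ : WeakDual ℂ (D A))).comp (conjD s) : D A →L[ℂ] ℂ), by
    have hc : ∀ R S : D A, conjD s (R * S) = conjD s R * conjD s S := fun R S =>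
      Subtype.ext (conj_mul (isDiag_of_mem_D R.2) s)
    constructor
    · intro h0
      have h1 : ξ (conjD s 1) = 0 := DFunLike.congr_fun h0 (1 : D A)
      have h2 : conjD s 1 = (⟨P s, P_mem_D s⟩ : D A) := Subtype.ext (by simp [conjD, P])
      rw [h2, show ξ ⟨P s, P_mem_D s⟩ = 1 from h] at h1
      exact one_ne_zero h1
    · intro R S
      change ξ (conjD s (R * S)) = ξ (conjD s R) * ξ (conjD s S)
      rw [hc, map_mul]⟩

/-- The shift map `σ : U → X_A`, where `U` is the domain above: it removes the first letter.
In terms of the configurations `ξ_g = ξ(T_g T_g^*)`, `g` in the free group over the alphabet,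
`σ(ξ)` is the translate `σ(ξ)_g = ξ_{sg}`, where `s` is the first letter of `ξ`. -/
def shift (ξ : shiftDomain A) : X A := removeLetter ξ.2.choose ξ.1 ξ.2.choose_spec

/-! ### Conformal measures -/

/-- A measure `μ` on `Y` is `D`-conformal in the sense of Denker and Urbański, for a map
`σ : U → Y` with `U ⊆ Y` and `D : U → [0, ∞)`, if `μ(σ(E)) = ∫_E D dμ` for every special set `E`,
that is, every measurable `E ⊆ U` on which `σ` is injective. -/
def IsConformal {Y : Type*} [MeasurableSpace Y] {U : Set Y} (σ : U → Y) (D : U → NNReal)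
    (μ : MeasureTheory.Measure Y) : Prop :=
  ∀ E : Set U, MeasurableSet (Subtype.val '' E) → Set.InjOn σ E →
    μ (σ '' E) = ∫⁻ x in E, D x ∂(μ.comap Subtype.val)

/-- The finite admissible words of length at least one that end with the letter `1`; these are the
nonempty stems of the elements of `X_A` outside `Σ_A`, for the renewal matrix. -/
def wordsEndingInOne (A : ℕ+ → ℕ+ → Prop) : Set (List ℕ+) :=
  {w | w.IsChain A ∧ w.getLast? = some 1}

end RenewalShift

end

open scoped ENNReal lp
noncomputable section

namespace RenewalShift

open Filter Topology MeasureTheory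

variable {A : ℕ+ → ℕ+ → Prop}

/-! ### Characters and cylinder projections -/

/-! For the renewal matrix `Q 1 = 1` and `Q (n + 1) = P n`, so a character is determined by its
values on the cylinder projections `T_α T_α^*` (`char_ext_cyl`). Iterating the shift on a character
either yields letters forever, and the character is a point of `Σ_A`, or reaches after finitely many
steps the unique character without a first letter. Since a letter `n + 1` forces a following `n`,
the finite word read off in the second case, the stem, is empty or ends with `1`
(`exists_stemChar`). Conversely, compactness of the spectrum gives a character for every stem. So
the complement of `Σ_A` is a countable set indexed by stems, on which the shift deletes the first
letter.

Conformality on singletons forces `μ{w} = e^{-β|w|} μ{∅}` (`IsConformal.measure_stemChar`), and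
measures with these weights are conformal (`isConformal_smul_stemMeasure`). Hence a normalised `μ`
exists exactly when the sum of `e^{-β|w|}` over all stems is finite, and it is then unique.

A stem starting with `t` can be preceded by exactly two letters, `1` and `t + 1`. There are
therefore `2 ^ (n - 1)` stems of length `n ≥ 1`, and with `r = e^{-β}` the sum is `1 + r (1 - 2r)⁻¹`
(`stemSum_eq`), finite exactly when `2r < 1`, that is, `β > log 2`. Without the empty stem this is
the series of the third assertion. -/

/-- The projection `T_α T_α^*` onto the cylinder of the word `α`, as an element of `D_A`. -/
def cyl (A : ℕ+ → ℕ+ → Prop) : List ℕ+ → D A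
  | [] => 1
  | s :: α => conjD s (cyl A α)

theorem coe_conjD (s : ℕ+) (R : D A) :
    ((conjD s R : D A) : H A →L[ℂ] H A) = T s * R.1 * star (T s) := rfl

theorem conjD_mul (s : ℕ+) (R S : D A) : conjD s (R * S) = conjD s R * conjD s S :=
  Subtype.ext (conj_mul (isDiag_of_mem_D R.2) s)

theorem conjD_one (s : ℕ+) : conjD s 1 = (⟨P s, P_mem_D s⟩ : D A) :=
  Subtype.ext (by simp [coe_conjD, P])

theorem cyl_singleton (s : ℕ+) : cyl A [s] = ⟨P s, P_mem_D s⟩ := conjD_one s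

theorem char_P_eq (ξ : X A) (s : ℕ+) :
    ξ ⟨P s, P_mem_D s⟩ = 0 ∨ HasFirstLetter ξ s := by
  have h := map_mul ξ (conjD s 1) (conjD s 1)
  rw [← conjD_mul, mul_one, conjD_one] at h
  by_cases h0 : ξ ⟨P s, P_mem_D s⟩ = 0
  · exact Or.inl h0
  · exact Or.inr (mul_left_cancel₀ h0 (by rw [mul_one]; exact h.symm))

theorem char_conjD_eq_zero {ξ : X A} {s : ℕ+} (h : ¬ HasFirstLetter ξ s) (R : D A) :
    ξ (conjD s R) = 0 := by
  have h1 : conjD s R = conjD s 1 * conjD s R := by rw [← conjD_mul, one_mul]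
  rw [h1, map_mul, conjD_one, (char_P_eq ξ s).resolve_right h, zero_mul]

theorem shift_apply (ξ : shiftDomain A) {s : ℕ+} (h : HasFirstLetter ξ.1 s) (R : D A) :
    shift ξ R = ξ.1 (conjD s R) := by
  obtain rfl := ξ.2.choose_spec.unique h
  rfl

/-- Characters which agree on the generators of `D_A` are equal. -/
theorem char_ext_gens {ξ η : X A}
    (h : ∀ (R) (hR : R ∈ gens A), ξ ⟨R, gens_subset_D hR⟩ = η ⟨R, gens_subset_D hR⟩) : ξ = η := by
  -- The generators are self-adjoint, so the star subalgebra they generate is the plain subalgebra;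
  -- the induction below then needs no case for the adjoint.
  have hstar : star (gens A) ⊆ gens A := by
    rintro R ⟨α, F, hR⟩
    have hF : star ((F.map Q).prod : H A →L[ℂ] H A) = (F.map Q).prod := by
      clear hR
      induction F with
      | nil => simp
      | cons i F ih =>
        have h1 : IsDiag ((F.map Q).prod : H A →L[ℂ] H A) :=
          isDiag_of_mem_gens ⟨[], F, by simp [Tword]⟩
        have h2 : star (Q i : H A →L[ℂ] H A) = Q i := by simp [Q]
        rw [List.map_cons, List.prod_cons, star_mul, ih, h2, h1.commute (isDiag_Q i)]
    refine ⟨α, F, ?_⟩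
    rw [← star_star R, hR]
    simp [hF, mul_assoc]
  have hadj : ∀ S, S ∈ StarAlgebra.adjoin ℂ (gens A) ↔ S ∈ Algebra.adjoin ℂ (gens A) := by
    intro S
    rw [← StarSubalgebra.mem_toSubalgebra, StarAlgebra.adjoin_toSubalgebra,
      Set.union_eq_self_of_subset_right hstar]
  have hle : ∀ {S}, S ∈ Algebra.adjoin ℂ (gens A) → S ∈ D A := fun hS =>
    StarSubalgebra.le_topologicalClosure _ ((hadj _).2 hS)
  have key : ∀ (S) (hS : S ∈ Algebra.adjoin ℂ (gens A)), ξ ⟨S, hle hS⟩ = η ⟨S, hle hS⟩ := by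
    intro S hS
    induction hS using Algebra.adjoin_induction with
    | mem x hx => exact h x hx
    | algebraMap r =>
      have h1 : (⟨algebraMap ℂ _ r, hle (Subalgebra.algebraMap_mem _ r)⟩ : D A)
        = algebraMap ℂ (D A) r := rfl
      rw [h1, AlgHomClass.commutes, AlgHomClass.commutes]
    | add x y hx hy ihx ihy =>
      have h1 : (⟨x + y, hle (add_mem hx hy)⟩ : D A) = ⟨x, hle hx⟩ + ⟨y, hle hy⟩ := rfl
      rw [h1, map_add, map_add, ihx, ihy]
    | mul x y hx hy ihx ihy =>
      have h1 : (⟨x * y, hle (mul_mem hx hy)⟩ : D A) = ⟨x, hle hx⟩ * ⟨y, hle hy⟩ := rfl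
      rw [h1, map_mul, map_mul, ihx, ihy]
  refine WeakDual.CharacterSpace.ext fun R => ?_
  have hclosed : IsClosed {R : D A | ξ R = η R} :=
    isClosed_eq (map_continuous ξ) (map_continuous η)
  refine closure_minimal (s := {R : D A | (R : H A →L[ℂ] H A) ∈ Algebra.adjoin ℂ (gens A)})
    (fun S hS => key S.1 hS) hclosed ?_
  rw [closure_subtype]
  refine closure_mono ?_ (show (R : H A →L[ℂ] H A) ∈ closure _ from R.2)
  exact fun S hS => ⟨⟨S, hle ((hadj S).1 hS)⟩, (hadj S).1 hS, rfl⟩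

/-- Row `n + 1` of the renewal matrix has its only `1` in column `n`, so the sequences that may
follow the letter `n + 1` are those that begin with `n`. -/
theorem Q_add_one_renewal (n : ℕ+) : (Q (n + 1) : H renewal →L[ℂ] H renewal) = P n := by
  classical
  ext v x
  change star (T (n + 1)) (T (n + 1) v) x = T n (star (T n) v) x
  rw [T_apply]
  split_ifs with h
  · have h1 : renewal (n + 1) (x.letter 0) := Or.inr (by rw [h])
    have h2 : renewal n (x.tail.letter 0) := h ▸ x.admissible 0
    rw [star_T_apply _ _ _ h1, T_apply_cons, star_T_apply _ _ _ h2,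
      ← (MarkovShift.eq_cons_iff h2).2 ⟨h, rfl⟩]
  · refine star_T_apply_of_not _ _ _ ?_
    rintro (h1 | h1)
    · exact (by simpa using congrArg PNat.val h1)
    · exact h (add_right_cancel h1).symm

/-- The map `R ↦ T_α R T_α^*` on `D_A`. -/
def conjWord : List ℕ+ → D A → D A
  | [], R => R
  | s :: α, R => conjD s (conjWord α R)

theorem coe_conjWord (α : List ℕ+) (R : D A) :
    (conjWord α R : H A →L[ℂ] H A) = Tword α * R.1 * star (Tword α) := by
  induction α with
  | nil => simp [Tword, conjWord]
  | cons s α ih => rw [conjWord, coe_conjD, ih, Tword_cons, star_mul]; simp only [mul_assoc]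

theorem conjWord_mul (α : List ℕ+) (R S : D A) :
    conjWord α (R * S) = conjWord α R * conjWord α S := by
  induction α with
  | nil => rfl
  | cons s α ih => rw [conjWord, ih, conjD_mul, conjWord, conjWord]

theorem cyl_append (α β : List ℕ+) : cyl A (α ++ β) = conjWord α (cyl A β) := by
  induction α with
  | nil => rfl
  | cons s α ih => rw [List.cons_append, cyl, ih, conjWord]

theorem prod_Q_mem_D (F : List ℕ+) : (F.map Q).prod ∈ D A :=
  gens_subset_D ⟨[], F, by simp [Tword]⟩

theorem Q_mem_D (i : ℕ+) : Q i ∈ D A := by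
  simpa using prod_Q_mem_D (A := A) [i]

theorem exists_cyl_eq_Q_renewal (i : ℕ+) :
    ∃ β, (⟨Q i, Q_mem_D i⟩ : D renewal) = cyl renewal β := by
  by_cases hi : i = 1
  · exact ⟨[], Subtype.ext (by rw [hi]; exact Q_one_renewal)⟩
  · obtain ⟨n, rfl⟩ := PNat.exists_eq_succ_of_ne_one hi
    exact ⟨[n], by rw [cyl_singleton]; exact Subtype.ext (Q_add_one_renewal n)⟩

/-- For the renewal matrix, a character is determined by its values on cylinders. -/
theorem char_ext_cyl {ξ η : X renewal} (h : ∀ α, ξ (cyl renewal α) = η (cyl renewal α)) :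
    ξ = η := by
  have key : ∀ α F : List ℕ+, ξ (conjWord α ⟨_, prod_Q_mem_D F⟩)
      = η (conjWord α ⟨_, prod_Q_mem_D F⟩) := by
    intro α F
    induction F with
    | nil =>
      have h1 := h (α ++ [])
      rw [cyl_append] at h1
      exact h1
    | cons i F ih =>
      have h1 : (⟨_, prod_Q_mem_D (i :: F)⟩ : D renewal)
          = ⟨Q i, Q_mem_D i⟩ * ⟨_, prod_Q_mem_D F⟩ := Subtype.ext (List.prod_cons ..)
      -- Each factor `Q i` is itself a cylinder projection, and conjugation by `T_α` turns it into
      -- the cylinder of `α ++ β`.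
      obtain ⟨β, hβ⟩ := exists_cyl_eq_Q_renewal i
      rw [h1, conjWord_mul, map_mul, map_mul, ih, hβ, ← cyl_append, h]
  refine char_ext_gens ?_
  rintro R ⟨α, F, hR⟩
  have h1 : (⟨R, gens_subset_D ⟨α, F, hR⟩⟩ : D renewal) = conjWord α ⟨_, prod_Q_mem_D F⟩ :=
    Subtype.ext (hR.trans (coe_conjWord α (⟨_, prod_Q_mem_D F⟩ : D renewal)).symm)
  rw [h1]
  exact key α F

/-! ### The shift and the inclusion of `Σ_A` -/

theorem hasFirstLetter_incl (x : MarkovShift A) : HasFirstLetter (incl x) (x.letter 0) := by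
  classical
  rw [HasFirstLetter, incl_apply, inner_delta]
  change T _ (star (T _) (delta x)) x = 1
  have h' : A (x.letter 0) (x.tail.letter 0) := x.admissible 0
  rw [T_apply, if_pos rfl, star_T_apply _ _ _ h', ← (MarkovShift.eq_cons_iff h').2 ⟨rfl, rfl⟩,
    delta_self]

theorem incl_conjD (x : MarkovShift A) (R : D A) :
    incl x (conjD (x.letter 0) R) = incl x.tail R := by
  classical
  rw [incl_apply, incl_apply, inner_delta, inner_delta]
  change T _ (R.1 (star (T _) (delta x))) x = _
  have h' : A (x.letter 0) (x.tail.letter 0) := x.admissible 0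
  rw [T_apply, if_pos rfl, isDiag_of_mem_D R.2, star_T_apply _ _ _ h',
    ← (MarkovShift.eq_cons_iff h').2 ⟨rfl, rfl⟩, delta_self, mul_one]

theorem shift_incl (x : MarkovShift A) (h : incl x ∈ shiftDomain A) :
    shift ⟨incl x, h⟩ = incl x.tail :=
  WeakDual.CharacterSpace.ext fun R => by
    rw [shift_apply _ (hasFirstLetter_incl x), incl_conjD]

/-- The first two letters of a character form an admissible pair. -/
theorem admissible_of_hasFirstLetter {ξ : shiftDomain A} {s t : ℕ+} (hs : HasFirstLetter ξ.1 s)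
    (ht : HasFirstLetter (shift ξ) t) : A s t := by
  by_contra hst
  have h0 : conjD s (⟨P t, P_mem_D t⟩ : D A) = 0 := by
    classical
    refine Subtype.ext ?_
    ext v y
    change T s (T t (star (T t) (star (T s) v))) y = 0
    rw [T_apply, T_apply]
    split_ifs with h1 h2
    · exact absurd (y.admissible 0) (by rw [h1]; exact fun h => hst (h2 ▸ h))
    · rfl
    · rfl
  rw [HasFirstLetter, shift_apply ξ hs, h0, map_zero] at ht
  exact zero_ne_one ht

/-- For the renewal matrix, a character with a first letter other than `1` has a second letter. -/
theorem hasFirstLetter_shift_renewal {ξ : shiftDomain renewal} {n : ℕ+}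
    (h : HasFirstLetter ξ.1 (n + 1)) : HasFirstLetter (shift ξ) n := by
  have h1 : conjD (n + 1) (⟨P n, P_mem_D n⟩ : D renewal) = ⟨P (n + 1), P_mem_D _⟩ := by
    refine Subtype.ext ?_
    change T (n + 1) * P n * star (T (n + 1)) = P (n + 1)
    rw [← Q_add_one_renewal, T_mul_Q, P]
  rw [HasFirstLetter, shift_apply ξ h, h1]
  exact h

/-- A character is determined by its first letter and its image under the shift. -/
theorem eq_of_shift_eq {ξ η : shiftDomain renewal} {s : ℕ+} (hξ : HasFirstLetter ξ.1 s)
    (hη : HasFirstLetter η.1 s) (h : shift ξ = shift η) : ξ = η := by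
  refine Subtype.ext (char_ext_cyl fun α => ?_)
  cases α with
  | nil => rw [cyl, map_one, map_one]
  | cons t α =>
    rw [cyl]
    by_cases hst : t = s
    · rw [hst, ← shift_apply ξ hξ, h, shift_apply η hη]
    · rw [char_conjD_eq_zero (fun h => hst (h.unique hξ)),
        char_conjD_eq_zero (fun h => hst (h.unique hη))]

/-- There is at most one character without a first letter. -/
theorem eq_of_not_mem_shiftDomain {ξ η : X renewal} (hξ : ξ ∉ shiftDomain renewal)
    (hη : η ∉ shiftDomain renewal) : ξ = η := by
  refine char_ext_cyl fun α => ?_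
  cases α with
  | nil => rw [cyl, map_one, map_one]
  | cons t α =>
    rw [cyl, char_conjD_eq_zero (fun h => hξ ⟨t, h⟩), char_conjD_eq_zero (fun h => hη ⟨t, h⟩)]

/-! ### The characters with a finite stem -/

/-- Completeness makes the character space compact, so that ultrafilters on it have limits. -/
instance : CompleteSpace (D A) := by
  unfold D; infer_instance

/-- The stems of the characters outside `Σ_A`, for the renewal matrix. -/
inductive IsStem : List ℕ+ → Prop
  | nil : IsStem []
  | one : IsStem [1]
  | cons {s t : ℕ+} {w : List ℕ+} : renewal s t → IsStem (t :: w) → IsStem (s :: t :: w)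

/-- The sequence `(n + 1) n ⋯ 2 1 1 1 ⋯`. -/
def descending (n : ℕ) : MarkovShift renewal where
  -- Truncated subtraction yields the constant tail of ones from `j = n` on.
  letter j := Nat.succPNat (n - j)
  admissible j := by
    by_cases h : n - j = 0
    · exact Or.inl (by rw [h]; rfl)
    · refine Or.inr (PNat.eq ?_)
      simp only [Nat.succPNat_coe, PNat.add_coe, PNat.one_coe]
      omega

open Classical in
/-- The sequence that begins with the word `w` and continues with `descending n`. -/
def stemSeq (w : List ℕ+) (n : ℕ) : MarkovShift renewal :=
  -- The `else` branch is a dummy value; it does not occur for stems, by `stemSeq_cons`.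
  w.foldr (fun s x => if h : renewal s (x.letter 0) then x.cons s h else x) (descending n)

/-- The character with the stem `w`. -/
def stemChar (w : List ℕ+) : X renewal :=
  -- The letter `n + 1` following `w` tends to infinity, so a limit point retains the letters of `w`
  -- and has none after them.
  ((hyperfilter ℕ).map fun n => incl (stemSeq w n)).lim

theorem tendsto_stemChar (w : List ℕ+) (R : D renewal) :
    Tendsto (fun n => incl (stemSeq w n) R) (hyperfilter ℕ) (𝓝 (stemChar w R)) := by
  have h : Tendsto (fun n => incl (stemSeq w n)) (hyperfilter ℕ) (𝓝 (stemChar w)) :=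
    Ultrafilter.le_nhds_lim ((hyperfilter ℕ).map fun n => incl (stemSeq w n))
  have hc : Continuous fun ξ : X renewal => ξ R :=
    (WeakDual.eval_continuous R).comp continuous_subtype_val
  exact (hc.tendsto _).comp h

theorem stemSeq_cons {s : ℕ+} {w : List ℕ+} (h : IsStem (s :: w)) (n : ℕ) :
    (stemSeq (s :: w) n).letter 0 = s ∧ (stemSeq (s :: w) n).tail = stemSeq w n := by
  have h0 : renewal s ((stemSeq w n).letter 0) := by
    cases h with
    | one => exact Or.inl rfl
    | @cons _ t w hst ht =>
      -- The prefix `t :: w` is itself a stem, so by induction none of its letters was dropped.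
      have : (stemSeq (t :: w) n).letter 0 = t := by
        clear hst
        generalize hl : t :: w = l at ht
        induction ht generalizing t w with
        | nil => cases hl
        | one =>
          obtain ⟨rfl, rfl⟩ := List.cons.inj hl
          have h1 : renewal 1 ((descending n).letter 0) := Or.inl rfl
          rw [stemSeq, List.foldr_cons, List.foldr_nil, dif_pos h1]; rfl
        | @cons s' t' w' hst' _ ih =>
          obtain ⟨rfl, rfl⟩ := List.cons.inj hl
          have h1 : renewal t ((stemSeq (t' :: w') n).letter 0) := by rw [ih rfl]; exact hst'
          rw [stemSeq, List.foldr_cons, ← stemSeq, dif_pos h1]; rfl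
      rwa [this]
  rw [stemSeq, List.foldr_cons, ← stemSeq, dif_pos h0]
  exact ⟨rfl, rfl⟩

/-- The sequence `descending n` begins with `n + 1`, so it lies in the cylinder of a fixed letter
`s` for one `n` only, and the hyperfilter ignores finite sets. -/
theorem stemChar_nil : stemChar [] ∉ shiftDomain renewal := by
  rintro ⟨s, hs⟩
  have h1 := tendsto_stemChar [] ⟨P s, P_mem_D s⟩
  rw [show stemChar [] ⟨P s, P_mem_D s⟩ = 1 from hs] at h1
  have h2 : ∀ᶠ n in (hyperfilter ℕ : Filter ℕ), incl (stemSeq [] n) ⟨P s, P_mem_D s⟩ = 0 := by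
    have h3 : ∀ᶠ n in (hyperfilter ℕ : Filter ℕ), n ≠ s.natPred :=
      hyperfilter_le_cofinite (Set.finite_singleton s.natPred).compl_mem_cofinite
    filter_upwards [h3] with n hn
    refine (char_P_eq _ s).resolve_right fun h => hn ?_
    have h4 : Nat.succPNat n = s := (hasFirstLetter_incl (descending n)).unique h
    rw [← h4, Nat.natPred_succPNat]
  exact one_ne_zero (tendsto_nhds_unique (h1.congr' h2) tendsto_const_nhds)

theorem hasFirstLetter_stemChar {s : ℕ+} {w : List ℕ+} (h : IsStem (s :: w)) :
    HasFirstLetter (stemChar (s :: w)) s := by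
  refine tendsto_nhds_unique (tendsto_stemChar (s :: w) ⟨P s, P_mem_D s⟩) ?_
  refine tendsto_const_nhds.congr fun n => ?_
  have := hasFirstLetter_incl (stemSeq (s :: w) n)
  rw [(stemSeq_cons h n).1] at this
  exact this.symm

theorem shift_stemChar {s : ℕ+} {w : List ℕ+} (h : IsStem (s :: w))
    (hU : stemChar (s :: w) ∈ shiftDomain renewal) :
    shift ⟨stemChar (s :: w), hU⟩ = stemChar w := by
  refine WeakDual.CharacterSpace.ext fun R => ?_
  rw [shift_apply _ (hasFirstLetter_stemChar h)]
  refine tendsto_nhds_unique (tendsto_stemChar (s :: w) _) ?_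
  refine (tendsto_stemChar w R).congr fun n => ?_
  have h1 := incl_conjD (stemSeq (s :: w) n) R
  rw [(stemSeq_cons h n).1, (stemSeq_cons h n).2] at h1
  exact h1.symm

theorem IsStem.tail {s : ℕ+} {w : List ℕ+} (h : IsStem (s :: w)) : IsStem w := by
  cases h with
  | one => exact .nil
  | cons _ h => exact h

theorem stemChar_mem_shiftDomain {s : ℕ+} {w : List ℕ+} (h : IsStem (s :: w)) :
    stemChar (s :: w) ∈ shiftDomain renewal := ⟨s, hasFirstLetter_stemChar h⟩

/-- The stem is recovered from the character by reading the first letter and shifting; the empty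
stem is detected by the absence of a first letter. -/
theorem stemChar_injOn : Set.InjOn stemChar {w | IsStem w} := by
  intro v hv w hw h
  induction v generalizing w with
  | nil =>
    cases w with
    | nil => rfl
    | cons t w => exact absurd (h ▸ stemChar_mem_shiftDomain hw) stemChar_nil
  | cons s v ih =>
    cases w with
    | nil => exact absurd (h ▸ stemChar_mem_shiftDomain hv) stemChar_nil
    | cons t w =>
      obtain rfl : s = t :=
        (hasFirstLetter_stemChar hv).unique (h ▸ hasFirstLetter_stemChar hw)
      have h1 : stemChar v = stemChar w := by
        rw [← shift_stemChar hv (stemChar_mem_shiftDomain hv),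
          ← shift_stemChar hw (stemChar_mem_shiftDomain hw)]
        congr 1
        exact Subtype.ext h
      rw [ih hv.tail hw.tail h1]

/-- The shift preserves `Σ_A`, where every point has a first letter, but it leads from a finite stem
to the letterless character. -/
theorem stemChar_notMem_SigmaA {w : List ℕ+} (hw : IsStem w) : stemChar w ∉ SigmaA renewal := by
  induction w with
  | nil =>
    rintro ⟨x, hx⟩
    exact stemChar_nil ⟨_, hx ▸ hasFirstLetter_incl x⟩
  | cons s w ih =>
    rintro ⟨x, hx⟩
    refine ih hw.tail ⟨x.tail, ?_⟩
    rw [← shift_stemChar hw (stemChar_mem_shiftDomain hw), ← shift_incl x ⟨_, hasFirstLetter_incl x⟩]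
    congr 1
    exact Subtype.ext hx

/-! ### Every character outside `Σ_A` has a finite stem -/

theorem exists_stemChar_of_shift {ξ : shiftDomain renewal} {w : List ℕ+} (hw : IsStem w)
    (h : shift ξ = stemChar w) : ∃ s, IsStem (s :: w) ∧ ξ.1 = stemChar (s :: w) := by
  obtain ⟨s, hs⟩ := ξ.2
  have hsw : IsStem (s :: w) := by
    cases w with
    | nil =>
      -- A letter `n + 1` would force the second letter `n`, but the letterless character supplies
      -- none; this is why nonempty stems end with `1`.
      by_cases h1 : s = 1
      · rw [h1]; exact .one
      · obtain ⟨n, rfl⟩ := PNat.exists_eq_succ_of_ne_one h1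
        exact absurd ⟨n, h ▸ hasFirstLetter_shift_renewal hs⟩ stemChar_nil
    | cons t w =>
      exact .cons (admissible_of_hasFirstLetter hs (h ▸ hasFirstLetter_stemChar hw)) hw
  refine ⟨s, hsw, congrArg Subtype.val (eq_of_shift_eq (ξ := ξ)
    (η := ⟨_, stemChar_mem_shiftDomain hsw⟩) hs (hasFirstLetter_stemChar hsw) ?_)⟩
  rw [h, shift_stemChar hsw]

open Classical in
/-- The extension of the shift to all characters by the identity. -/
def shiftExt (ξ : X renewal) : X renewal :=
  if h : ξ ∈ shiftDomain renewal then shift ⟨ξ, h⟩ else ξ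

theorem shiftExt_of_mem {ξ : X renewal} (h : ξ ∈ shiftDomain renewal) :
    shiftExt ξ = shift ⟨ξ, h⟩ := dif_pos h

/-- The characters outside `Σ_A` are those with a finite stem. -/
theorem exists_stemChar {ξ : X renewal} (hξ : ξ ∉ SigmaA renewal) :
    ∃ w, IsStem w ∧ ξ = stemChar w := by
  -- Either the orbit reaches the letterless character, and the stem is rebuilt backwards from it,
  -- or it yields an infinite admissible sequence whose character agrees with `ξ` on all cylinders.
  by_cases hk : ∃ k, shiftExt^[k] ξ ∉ shiftDomain renewal
  · obtain ⟨k, hk⟩ := hk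
    clear hξ
    induction k generalizing ξ with
    | zero => exact ⟨[], .nil, eq_of_not_mem_shiftDomain hk stemChar_nil⟩
    | succ k ih =>
      by_cases hU : ξ ∈ shiftDomain renewal
      · obtain ⟨w, hw, h⟩ := ih hk
        rw [shiftExt_of_mem hU] at h
        obtain ⟨s, hs⟩ := exists_stemChar_of_shift hw h
        exact ⟨s :: w, hs⟩
      · exact ⟨[], .nil, eq_of_not_mem_shiftDomain hU stemChar_nil⟩
  · push Not at hk
    choose l hl using hk
    let x : MarkovShift renewal := ⟨l, fun j => by
      refine admissible_of_hasFirstLetter (ξ := ⟨shiftExt^[j] ξ, l j, hl j⟩) (hl j) ?_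
      have h := hl (j + 1)
      rwa [Function.iterate_succ_apply', shiftExt_of_mem ⟨l j, hl j⟩] at h⟩
    refine absurd ⟨x, char_ext_cyl fun α => ?_⟩ hξ
    have hx : ∀ j, HasFirstLetter (shiftExt^[j] ξ) (x.letter j) := hl
    clear_value x
    clear hl l hξ
    induction α generalizing ξ x with
    | nil => rw [cyl, map_one, map_one]
    | cons s α ih =>
      rw [cyl]
      by_cases hs : s = x.letter 0
      · have hU : ξ ∈ shiftDomain renewal := ⟨_, hx 0⟩
        rw [hs, incl_conjD, ← shift_apply ⟨ξ, hU⟩ (hx 0), ← shiftExt_of_mem]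
        exact ih x.tail fun j => hx (j + 1)
      · rw [char_conjD_eq_zero fun h => hs (h.unique (hasFirstLetter_incl x)),
          char_conjD_eq_zero (ξ := ξ) fun h => hs (h.unique (hx 0))]

/-! ### Counting stems -/

/-- The nonempty stem encoded by a list of booleans: in front of a stem there are exactly two
admissible letters. -/
def boolWord : List Bool → List ℕ+
  | [] => [1]
  | b :: l => (if b then 1 else (boolWord l).headI + 1) :: boolWord l

theorem length_boolWord (l : List Bool) : (boolWord l).length = l.length + 1 := by
  induction l with
  | nil => rfl
  | cons b l ih => rw [boolWord, List.length_cons, ih, List.length_cons]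

theorem boolWord_ne_nil (l : List Bool) : boolWord l ≠ [] :=
  List.ne_nil_of_length_pos (by rw [length_boolWord]; omega)

theorem isStem_boolWord (l : List Bool) : IsStem (boolWord l) := by
  induction l with
  | nil => exact .one
  | cons b l ih =>
    obtain ⟨t, w, h⟩ := List.exists_cons_of_ne_nil (boolWord_ne_nil l)
    rw [boolWord]
    rw [h] at ih ⊢
    refine .cons ?_ ih
    cases b
    · exact Or.inr rfl
    · exact Or.inl rfl

theorem boolWord_injective : Function.Injective boolWord := by
  intro l
  induction l with
  | nil =>
    intro l' h
    have h1 := congrArg List.length h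
    rw [length_boolWord, length_boolWord] at h1
    exact (List.length_eq_zero_iff.1 (by simpa using h1.symm)).symm
  | cons b l ih =>
    intro l' h
    cases l' with
    | nil =>
      have h1 := congrArg List.length h
      rw [length_boolWord, length_boolWord] at h1
      simp at h1
    | cons b' l' =>
      rw [boolWord, boolWord] at h
      obtain ⟨h1, h2⟩ := List.cons.inj h
      obtain rfl := ih h2
      have h3 : (boolWord l).headI + 1 ≠ 1 := fun h => (PNat.lt_add_left 1 _).ne' h
      cases b <;> cases b'
      · rfl
      · exact absurd h1 h3
      · exact absurd h1.symm h3
      · rfl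

theorem IsStem.exists_boolWord {w : List ℕ+} (hw : IsStem w) (h : w ≠ []) :
    ∃ l, boolWord l = w := by
  induction hw with
  | nil => exact absurd rfl h
  | one => exact ⟨[], rfl⟩
  | @cons s t w hst _ ih =>
    obtain ⟨l, hl⟩ := ih (List.cons_ne_nil t w)
    rcases hst with rfl | rfl
    · exact ⟨true :: l, by rw [boolWord, hl]; rfl⟩
    · exact ⟨false :: l, by rw [boolWord, hl]; rfl⟩

theorem mem_wordsEndingInOne_iff {w : List ℕ+} :
    w ∈ wordsEndingInOne renewal ↔ IsStem w ∧ w ≠ [] := by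
  constructor
  · rintro ⟨h1, h2⟩
    refine ⟨?_, by rintro rfl; simp at h2⟩
    induction w with
    | nil => exact .nil
    | cons s w ih =>
      cases w with
      | nil =>
        obtain rfl : s = 1 := by simpa using h2
        exact .one
      | cons t w =>
        rw [List.isChain_cons_cons] at h1
        exact .cons h1.1 (ih h1.2 (by simpa using h2))
  · rintro ⟨h, h0⟩
    induction h with
    | nil => exact absurd rfl h0
    | one => exact ⟨List.isChain_singleton 1, rfl⟩
    | @cons s t w hst _ ih =>
      have := ih (List.cons_ne_nil t w)
      exact ⟨List.isChain_cons_cons.2 ⟨hst, this.1⟩, by simpa using this.2⟩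

/-- There are `2 ^ n` lists of length `n`, so this is a geometric series. The identity also covers
divergence: for `2 * r ≥ 1` the truncated difference is `0` and its inverse is `∞`. -/
theorem tsum_pow_length_list_bool (r : ℝ≥0∞) :
    ∑' l : List Bool, r ^ l.length = (1 - 2 * r)⁻¹ := by
  rw [← (Equiv.sigmaFiberEquiv (List.length (α := Bool))).tsum_eq]
  have h := ENNReal.tsum_sigma fun (n : ℕ) (l : {l : List Bool // l.length = n}) => r ^ l.1.length
  refine h.trans ?_
  rw [← ENNReal.tsum_geometric]
  refine tsum_congr fun n => ?_
  have h1 : ∀ l : {l : List Bool // l.length = n}, r ^ l.1.length = r ^ n := fun l => by rw [l.2]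
  rw [tsum_congr h1]
  change ∑' _ : List.Vector Bool n, r ^ n = _
  rw [tsum_fintype, Finset.sum_const, Finset.card_univ, card_vector, Fintype.card_bool,
    nsmul_eq_mul, mul_pow]
  norm_cast

/-- The generating function of the words that end with `1`, by length. -/
theorem tsum_pow_length_wordsEndingInOne (r : ℝ≥0∞) :
    ∑' w : wordsEndingInOne renewal, r ^ (w : List ℕ+).length = r * (1 - 2 * r)⁻¹ := by
  let e : List Bool ≃ wordsEndingInOne renewal := Equiv.ofBijective
    (fun l => ⟨boolWord l, mem_wordsEndingInOne_iff.2 ⟨isStem_boolWord l, boolWord_ne_nil l⟩⟩)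
    ⟨fun l l' h => boolWord_injective (congrArg Subtype.val h), fun w => by
      obtain ⟨h1, h2⟩ := mem_wordsEndingInOne_iff.1 w.2
      obtain ⟨l, hl⟩ := h1.exists_boolWord h2
      exact ⟨l, Subtype.ext hl⟩⟩
  rw [← e.tsum_eq, ← tsum_pow_length_list_bool, ← ENNReal.tsum_mul_left]
  refine tsum_congr fun l => ?_
  change r ^ (boolWord l).length = _
  rw [length_boolWord, pow_succ']

/-- The set of stems. -/
abbrev Stem : Type := {w : List ℕ+ // IsStem w}

/-- The generating function of the stems, by length. -/
def stemSum (r : ℝ≥0∞) : ℝ≥0∞ := ∑' w : Stem, r ^ w.1.length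

theorem stemSum_eq (r : ℝ≥0∞) : stemSum r = 1 + r * (1 - 2 * r)⁻¹ := by
  let e : Unit ⊕ wordsEndingInOne renewal ≃ Stem := Equiv.ofBijective
    (Sum.elim (fun _ => ⟨[], .nil⟩) fun w => ⟨w.1, (mem_wordsEndingInOne_iff.1 w.2).1⟩) (by
      constructor
      · rintro (_ | v) (_ | w) h
        · rfl
        · exact absurd (congrArg Subtype.val h).symm (mem_wordsEndingInOne_iff.1 w.2).2
        · exact absurd (congrArg Subtype.val h) (mem_wordsEndingInOne_iff.1 v.2).2
        · exact congrArg Sum.inr (Subtype.ext (congrArg (fun u : Stem => u.1) h))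
      · rintro ⟨w, hw⟩
        by_cases h : w = []
        · exact ⟨.inl (), Subtype.ext h.symm⟩
        · exact ⟨.inr ⟨w, mem_wordsEndingInOne_iff.2 ⟨hw, h⟩⟩, rfl⟩)
  rw [stemSum, ← e.tsum_eq, ENNReal.summable.tsum_sum ENNReal.summable,
    ← tsum_pow_length_wordsEndingInOne, tsum_fintype, Fintype.sum_unique]
  congr 1
  exact pow_zero r

theorem stemSum_ne_zero (r : ℝ≥0∞) : stemSum r ≠ 0 := by
  rw [stemSum_eq]; simp

theorem stemSum_ne_top {r : ℝ≥0∞} (h : 2 * r < 1) : stemSum r ≠ ∞ := by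
  have hr : r ≠ ∞ := by
    rintro rfl
    simp at h
  rw [stemSum_eq]
  exact ENNReal.add_ne_top.2 ⟨ENNReal.one_ne_top, ENNReal.mul_ne_top hr
    (ENNReal.inv_ne_top.2 (tsub_pos_of_lt h).ne')⟩

theorem mul_inv_one_sub_eq_top {r : ℝ≥0∞} (h : 1 ≤ 2 * r) : r * (1 - 2 * r)⁻¹ = ∞ := by
  have hr : r ≠ 0 := by
    rintro rfl
    simp at h
  rw [tsub_eq_zero_of_le h, ENNReal.inv_zero, ENNReal.mul_top hr]

/-! ### Conformal measures -/

theorem measurableSet_shiftDomain {A : ℕ+ → ℕ+ → Prop} : MeasurableSet (shiftDomain A) := by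
  have h : shiftDomain A = ⋃ s : ℕ+, {ξ : X A | ξ ⟨P s, P_mem_D s⟩ = 1} := by
    ext ξ
    simp [shiftDomain, HasFirstLetter]
  rw [h]
  refine MeasurableSet.iUnion fun s => IsClosed.measurableSet ?_
  exact isClosed_eq ((WeakDual.eval_continuous _).comp continuous_subtype_val) continuous_const

theorem isConformal_const_iff {Y : Type*} [MeasurableSpace Y] {U : Set Y} (hU : MeasurableSet U)
    {σ : U → Y} {c : NNReal} {μ : Measure Y} :
    IsConformal σ (fun _ => c) μ ↔ ∀ E : Set U, MeasurableSet (Subtype.val '' E) →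
      Set.InjOn σ E → μ (σ '' E) = c * μ (Subtype.val '' E) := by
  refine forall_congr' fun E => forall_congr' fun _ => forall_congr' fun _ => ?_
  rw [lintegral_const, Measure.restrict_apply_univ,
    (MeasurableEmbedding.subtype_coe hU).comap_apply]

/-- Conformality on the singleton of `stemChar (s :: w)`, which the shift sends to `stemChar w`,
gives one factor `c⁻¹` per letter. -/
theorem IsConformal.measure_stemChar {c : NNReal} (hc : c ≠ 0) {μ : Measure (X renewal)}
    (h : IsConformal shift (fun _ => c) μ) {w : List ℕ+} (hw : IsStem w) :
    μ {stemChar w} = (c⁻¹ : ℝ≥0∞) ^ w.length * μ {stemChar []} := by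
  rw [isConformal_const_iff measurableSet_shiftDomain] at h
  induction w with
  | nil => simp
  | cons s w ih =>
    have h1 := h {⟨_, stemChar_mem_shiftDomain hw⟩} (by simp) (Set.injOn_singleton _ _)
    rw [Set.image_singleton, Set.image_singleton, shift_stemChar hw, ih hw.tail] at h1
    rw [List.length_cons, pow_succ', mul_assoc, h1, ← mul_assoc,
      ENNReal.inv_mul_cancel (by simpa using hc) ENNReal.coe_ne_top, one_mul]

/-- The measure with the mass `r ^ |w|` at the character with the stem `w`. -/
def stemMeasure (r : ℝ≥0∞) : Measure (X renewal) :=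
  Measure.sum fun w : Stem => r ^ w.1.length • Measure.dirac (stemChar w.1)

/-- The measure is a countable sum of point masses, so the formula holds for arbitrary sets; it thus
applies to `Σ_A` and to images `shift '' E` without proof that these are measurable. -/
theorem stemMeasure_apply (r : ℝ≥0∞) (S : Set (X renewal)) :
    stemMeasure r S = ∑' w : {w : Stem | stemChar w.1 ∈ S}, r ^ w.1.1.length := by
  rw [stemMeasure, Measure.sum_apply_of_countable,
    tsum_subtype {w : Stem | stemChar w.1 ∈ S} fun w => r ^ w.1.length]
  refine tsum_congr fun w => ?_
  rw [Measure.smul_apply, Measure.dirac_apply]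
  by_cases h : stemChar w.1 ∈ S
  · simp [h]
  · simp [h]

theorem stemMeasure_univ (r : ℝ≥0∞) : stemMeasure r Set.univ = stemSum r := by
  rw [stemMeasure, Measure.sum_apply_of_countable, stemSum]
  simp

theorem stemMeasure_SigmaA (r : ℝ≥0∞) : stemMeasure r (SigmaA renewal) = 0 := by
  rw [stemMeasure_apply, ENNReal.tsum_eq_zero]
  exact fun w => absurd w.2 (stemChar_notMem_SigmaA w.1.2)

/-- A measure which vanishes on `Σ_A` is carried by the characters with a finite stem. -/
theorem eq_sum_dirac_of_SigmaA {μ : Measure (X renewal)} (h : μ (SigmaA renewal) = 0) :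
    μ = Measure.sum fun w : Stem => μ {stemChar w.1} • Measure.dirac (stemChar w.1) := by
  have h1 : ∀ᵐ ξ ∂μ, ξ ∈ ⋃ w : Stem, {stemChar w.1} := by
    refine measure_mono_null (fun ξ hξ => ?_) h
    by_contra h2
    obtain ⟨w, hw, rfl⟩ := exists_stemChar h2
    exact hξ (Set.mem_iUnion.2 ⟨⟨w, hw⟩, rfl⟩)
  have h2 : Pairwise (Function.onFun Disjoint fun w : Stem => ({stemChar w.1} : Set (X renewal))) :=
    fun v w hvw => Set.disjoint_singleton.2 fun h =>
      hvw (Subtype.ext (stemChar_injOn v.2 w.2 h))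
  conv_lhs => rw [← Measure.restrict_eq_self_of_ae_mem h1,
    Measure.restrict_iUnion h2 fun _ => measurableSet_singleton _]
  simp only [Measure.restrict_singleton]

/-- Only the mass of the letterless character is free: the measure is carried by the stem
characters, and conformality fixes all other masses from that one. -/
theorem IsConformal.eq_smul_stemMeasure {c : NNReal} (hc : c ≠ 0) {μ : Measure (X renewal)}
    (h : IsConformal shift (fun _ => c) μ) (h0 : μ (SigmaA renewal) = 0) :
    μ = μ {stemChar []} • stemMeasure (c⁻¹ : ℝ≥0∞) := by
  conv_lhs => rw [eq_sum_dirac_of_SigmaA h0]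
  ext S _
  rw [Measure.smul_apply, stemMeasure, Measure.sum_apply_of_countable,
    Measure.sum_apply_of_countable, smul_eq_mul, ← ENNReal.tsum_mul_left]
  refine tsum_congr fun w => ?_
  rw [h.measure_stemChar hc w.2, Measure.smul_apply, Measure.smul_apply, smul_eq_mul, smul_eq_mul]
  ring

/-- Deleting the first letter is a bijection from the stems in `E` to the stems in `shift '' E`, and
it multiplies each weight by `c`. -/
theorem isConformal_smul_stemMeasure {c : NNReal} (hc : c ≠ 0) (a : ℝ≥0∞) :
    IsConformal shift (fun _ => c) (a • stemMeasure (c⁻¹ : ℝ≥0∞)) := by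
  rw [isConformal_const_iff measurableSet_shiftDomain]
  intro E _ hE
  have htail : ∀ w : {w : Stem | stemChar w.1 ∈ Subtype.val '' E}, ∃ (s : ℕ+) (v : List ℕ+)
      (hsv : IsStem (s :: v)), w.1.1 = s :: v ∧
        (⟨_, stemChar_mem_shiftDomain hsv⟩ : shiftDomain renewal) ∈ E := by
    rintro ⟨⟨w, hw⟩, ξ, hξ, hξw⟩
    cases w with
    | nil => exact absurd (hξw ▸ ξ.2) stemChar_nil
    | cons s v =>
      refine ⟨s, v, hw, rfl, ?_⟩
      convert hξ
      exact hξw.symm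
  let f : {w : Stem | stemChar w.1 ∈ Subtype.val '' E} → {w : Stem | stemChar w.1 ∈ shift '' E} :=
    fun w => ⟨⟨w.1.1.tail, by
      obtain ⟨s, v, hsv, h1, -⟩ := htail w
      rw [h1]; exact hsv.tail⟩, by
      obtain ⟨s, v, hsv, h1, h2⟩ := htail w
      refine ⟨_, h2, ?_⟩
      rw [shift_stemChar hsv]
      change stemChar v = stemChar w.1.1.tail
      rw [h1, List.tail_cons]⟩
  -- Injectivity is that of the shift on `E`; surjectivity holds because a preimage of a stem
  -- character is again a stem character.
  have hf : Function.Bijective f := by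
    constructor
    · intro w w' h
      obtain ⟨s, v, hsv, h1, h2⟩ := htail w
      obtain ⟨s', v', hsv', h1', h2'⟩ := htail w'
      have h3 : w.1.1.tail = w'.1.1.tail := congrArg (fun u => u.1.1) h
      rw [h1, h1', List.tail_cons, List.tail_cons] at h3
      have h4 := congrArg Subtype.val (hE h2 h2' (by
        rw [shift_stemChar hsv, shift_stemChar hsv', h3]))
      exact Subtype.ext (Subtype.ext (by rw [h1, h1']; exact stemChar_injOn hsv hsv' h4))
    · rintro ⟨⟨w, hw⟩, ξ, hξ, hξw⟩
      obtain ⟨s, hsw, h⟩ := exists_stemChar_of_shift hw hξw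
      exact ⟨⟨⟨s :: w, hsw⟩, ξ, hξ, h⟩, rfl⟩
  rw [Measure.smul_apply, Measure.smul_apply, smul_eq_mul, smul_eq_mul, mul_left_comm]
  congr 1
  rw [stemMeasure_apply, stemMeasure_apply, ← (Equiv.ofBijective f hf).tsum_eq,
    ← ENNReal.tsum_mul_left]
  refine tsum_congr fun w => ?_
  obtain ⟨s, v, hsv, h1, -⟩ := htail w
  change (c⁻¹ : ℝ≥0∞) ^ w.1.1.tail.length = _
  rw [h1, List.tail_cons, List.length_cons, pow_succ', ← mul_assoc,
    ENNReal.mul_inv_cancel (by simpa using hc) ENNReal.coe_ne_top, one_mul]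

/-- There is a unique conformal probability measure that vanishes on `Σ_A` if the generating
function of the stems converges. -/
theorem existsUnique_isConformal {c : NNReal} (hc : c ≠ 0) (h : stemSum (c⁻¹ : ℝ≥0∞) ≠ ∞) :
    ∃! μ : Measure (X renewal), IsProbabilityMeasure μ ∧ IsConformal shift (fun _ => c) μ ∧
      μ (SigmaA renewal) = 0 := by
  refine ⟨(stemSum (c⁻¹ : ℝ≥0∞))⁻¹ • stemMeasure (c⁻¹ : ℝ≥0∞),
    ⟨⟨?_⟩, isConformal_smul_stemMeasure hc _, ?_⟩, ?_⟩
  · rw [Measure.smul_apply, stemMeasure_univ, smul_eq_mul,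
      ENNReal.inv_mul_cancel (stemSum_ne_zero _) h]
  · rw [Measure.smul_apply, stemMeasure_SigmaA, smul_zero]
  · rintro μ ⟨hμ, hconf, h0⟩
    have h1 := hconf.eq_smul_stemMeasure hc h0
    -- Total mass one determines the remaining free parameter.
    have h2 : μ {stemChar []} * stemSum (c⁻¹ : ℝ≥0∞) = 1 := by
      rw [← stemMeasure_univ, ← smul_eq_mul, ← Measure.smul_apply, ← h1, measure_univ]
    rw [← ENNReal.eq_inv_of_mul_eq_one_left h2]
    exact h1

/-- There is no conformal probability measure that vanishes on `Σ_A` if the generating function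
of the stems diverges. -/
theorem not_exists_isConformal {c : NNReal} (hc : c ≠ 0) (h : stemSum (c⁻¹ : ℝ≥0∞) = ∞) :
    ¬ ∃ μ : Measure (X renewal), IsProbabilityMeasure μ ∧ IsConformal shift (fun _ => c) μ ∧
      μ (SigmaA renewal) = 0 := by
  rintro ⟨μ, hμ, hconf, h0⟩
  have h1 := hconf.eq_smul_stemMeasure hc h0
  have h2 : μ {stemChar []} * ∞ = 1 := by
    rw [← h, ← stemMeasure_univ, ← smul_eq_mul, ← Measure.smul_apply, ← h1, measure_univ]
  -- A multiple of `∞` is `0` or `∞`, never `1`.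
  by_cases h3 : μ {stemChar []} = 0
  · rw [h3, zero_mul] at h2
    exact zero_ne_one h2
  · rw [ENNReal.mul_top h3] at h2
    exact ENNReal.top_ne_one h2

/-! ### The critical inverse temperature and the conclusion -/

theorem inv_toNNReal_exp (β : ℝ) :
    ((Real.toNNReal (Real.exp β) : ℝ≥0∞))⁻¹ = ENNReal.ofReal (Real.exp (-β)) := by
  rw [Real.exp_neg, ENNReal.ofReal_inv_of_pos (Real.exp_pos β)]
  rfl

/-- In this form the comparison of `2 * r` with `1`, for `r = e^{-β}`, is the sign of `log 2 - β`.
-/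
theorem two_mul_inv_exp (β : ℝ) :
    2 * ((Real.toNNReal (Real.exp β) : ℝ≥0∞))⁻¹ = ENNReal.ofReal (Real.exp (Real.log 2 - β)) := by
  rw [inv_toNNReal_exp, sub_eq_add_neg, Real.exp_add, Real.exp_log two_pos,
    ENNReal.ofReal_mul zero_le_two, ENNReal.ofReal_ofNat]

end RenewalShift

end

theorem mainTheorem3 :
    (∀ β : ℝ, Real.log 2 < β →
      ∃! μ : MeasureTheory.Measure (RenewalShift.X RenewalShift.renewal),
        MeasureTheory.IsProbabilityMeasure μ ∧
        RenewalShift.IsConformal RenewalShift.shift (fun _ => Real.toNNReal (Real.exp β)) μ ∧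
        μ (RenewalShift.SigmaA RenewalShift.renewal) = 0) ∧
    (∀ β : ℝ, β ≤ Real.log 2 →
      ¬ ∃ μ : MeasureTheory.Measure (RenewalShift.X RenewalShift.renewal),
        MeasureTheory.IsProbabilityMeasure μ ∧
        RenewalShift.IsConformal RenewalShift.shift (fun _ => Real.toNNReal (Real.exp β)) μ ∧
        μ (RenewalShift.SigmaA RenewalShift.renewal) = 0) ∧
    ¬ Summable (fun w : RenewalShift.wordsEndingInOne RenewalShift.renewal =>
      Real.exp (-(Real.log 2 * (w : List ℕ+).length))) := by
  have hc : ∀ β : ℝ, Real.toNNReal (Real.exp β) ≠ 0 := fun β =>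
    (Real.toNNReal_pos.2 (Real.exp_pos β)).ne'
  refine ⟨fun β hβ => ?_, fun β hβ => ?_, fun h => ?_⟩
  · refine RenewalShift.existsUnique_isConformal (hc β) (RenewalShift.stemSum_ne_top ?_)
    rw [RenewalShift.two_mul_inv_exp, ← ENNReal.ofReal_one]
    refine (ENNReal.ofReal_lt_ofReal_iff one_pos).2 ?_
    rw [Real.exp_lt_one_iff]
    linarith
  · refine RenewalShift.not_exists_isConformal (hc β) ?_
    rw [RenewalShift.stemSum_eq, RenewalShift.mul_inv_one_sub_eq_top, add_top]
    rw [RenewalShift.two_mul_inv_exp, ← ENNReal.ofReal_one]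
    refine ENNReal.ofReal_le_ofReal ?_
    rw [Real.one_le_exp_iff]
    linarith
  -- Real summability would make the sum in `ℝ≥0∞` finite, but at `r = 1/2` the generating function
  -- equals `∞`.
  · refine h.tsum_ofReal_ne_top ?_
    have h1 : ∀ n : ℕ, ENNReal.ofReal (Real.exp (-(Real.log 2 * n)))
        = ((Real.toNNReal (Real.exp (Real.log 2)) : ENNReal)⁻¹) ^ n := fun n => by
      rw [RenewalShift.inv_toNNReal_exp, ← ENNReal.ofReal_pow (Real.exp_pos _).le,
        ← Real.exp_nat_mul]
      congr 2
      ring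
    simp only [h1]
    rw [RenewalShift.tsum_pow_length_wordsEndingInOne, RenewalShift.mul_inv_one_sub_eq_top]
    rw [RenewalShift.two_mul_inv_exp, sub_self, Real.exp_zero, ENNReal.ofReal_one]
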